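/- **Theorem (Linkedness of the cube).** Let $d \ge 0$ be an integer with $d \neq 3$, and let $P$ be a $d$-cube, that is, a convex polytope in some $\mathbb{R}^n$ whose face lattice is isomorphic to the face lattice of the standard cube $[0,1]^d$. Then the graph of $P$, formed by the vertices and edges of $P$, is $\lfloor (d+1)/2 \rfloor$-linked. Here a graph $G$ is *$k$-linked* if it has at least $2k$ vertices and, for every set of $2k$ distinct vertices of $G$ and every partition of this set into unordered pairs $\{s_1,t_1\},\ldots,\{s_k,t_k\}$, there are pairwise vertex-disjoint paths $L_1,\ldots,L_k$ in $G$ such that $L_i$ joins $s_i$ and $t_i$ for each $i$. -/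

import Mathlib

/-- A graph `G` is `k`-linked if it has at least `2k` vertices and, for every choice of `2k`
distinct vertices organised (and labelled) in `k` pairs `{s i, t i}`, there are pairwise
vertex-disjoint paths in `G`, the `i`-th one joining `s i` and `t i`. -/
def SimpleGraph.IsKLinked {V : Type*} (G : SimpleGraph V) (k : ℕ) : Prop :=
  ((2 * k : ℕ) : ℕ∞) ≤ ENat.card V ∧
    ∀ s t : Fin k → V, Function.Injective (Sum.elim s t) →
      ∃ L : (i : Fin k) → G.Path (s i) (t i),
        ∀ i j : Fin k, i ≠ j → (L i).1.support.Disjoint (L j).1.support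

namespace Polytope

/-- A polytope in `ℝⁿ`: the convex hull of a finite set of points. -/
def IsPolytope {n : ℕ} (P : Set (Fin n → ℝ)) : Prop :=
  ∃ S : Set (Fin n → ℝ), S.Finite ∧ P = convexHull ℝ S

/-- The face lattice of `P`, ordered by inclusion. A face is the empty set or the set of points of
`P` at which some linear functional attains its maximum over `P` (the zero functional gives `P`
itself). -/
abbrev FaceLattice {n : ℕ} (P : Set (Fin n → ℝ)) : Type :=
  {F : Set (Fin n → ℝ) // IsExposed ℝ P F}

/-- Two polytopes are combinatorially equivalent if their face lattices are isomorphic. -/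
def CombinatoriallyEquivalent {m n : ℕ} (P : Set (Fin m → ℝ)) (Q : Set (Fin n → ℝ)) : Prop :=
  Nonempty (FaceLattice P ≃o FaceLattice Q)

/-- A `d`-cube: a polytope combinatorially equivalent to the standard cube `[0,1]ᵈ`. -/
def IsCube {n : ℕ} (d : ℕ) (P : Set (Fin n → ℝ)) : Prop :=
  IsPolytope P ∧ CombinatoriallyEquivalent P (Set.Icc (0 : Fin d → ℝ) 1)

/-- The vertices of `P`: the points `v` such that `{v}` is a face. -/
abbrev Vertex {n : ℕ} (P : Set (Fin n → ℝ)) : Type :=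
  {v : Fin n → ℝ // IsExposed ℝ P {v}}

/-- The graph of a polytope `P`: distinct vertices `u`, `v` are adjacent if and only if the segment
between them is a face (an edge) of `P`. -/
def graph {n : ℕ} (P : Set (Fin n → ℝ)) : SimpleGraph (Vertex P) where
  Adj u v := u ≠ v ∧ IsExposed ℝ P (segment ℝ u.1 v.1)
  symm := ⟨fun u v h => ⟨h.1.symm, by rw [segment_symm]; exact h.2⟩⟩
  loopless := ⟨fun _ h => h.1 rfl⟩

end Polytope

/-!
An isomorphism of face lattices maps vertices, the atoms, to vertices and edges to edges, so it
suffices to treat the graph on `{0, 1}ᵈ` in which two points are adjacent if they differ in one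
coordinate.

There we prove a statement suited to induction on the number of pairs: the ends of `k` pairs in a
face of dimension `m` can be joined by disjoint paths avoiding a further set `Z` of vertices,
provided that `2k + |Z| ≤ m + 1` and that `k ≤ 1` or `m ≥ 4`. A single pair is joined because
removing fewer than `m` vertices does not disconnect the face. For `k ≥ 2`, the ends together with
`Z` are at most `m + 1` vertices, and so few vertices span at most one edge in some direction:
projecting along a direction merges the ends of the edges in that direction and keeps an edge in
every other direction, so two edges in each direction would require at least `m + 2` vertices. One
pair is then joined inside one of the two facets orthogonal to this direction, up to a last step of
its other end into that facet. The other pairs are moved along the direction to the opposite facet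
and joined there by induction, with that other end added to `Z`. The path in the first facet exists
since some obstacle lies outside that facet; when all of them lie in the facet, it exists since not
every pair can have an end all of whose neighbours in the facet are obstacles.

One pair and one dimension are lost in each step while `Z` grows by at most one vertex, so the
inequality is preserved. It forces `m ≥ 5` if `k ≥ 3`, so `m ≥ 4` survives a step as long as at
least two pairs are left.
-/

namespace CubeGraph

section Linkable

variable {V W κ : Type*} {G : SimpleGraph V} {A B : Set V} {u v w : V}

/-- `u` and `v` are the ends of a walk of `G` all of whose vertices lie in `A`. -/
def ReachableIn (G : SimpleGraph V) (A : Set V) (u v : V) : Prop :=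
  ∃ p : G.Walk u v, ∀ w ∈ p.support, w ∈ A

namespace ReachableIn

lemma refl (h : u ∈ A) : ReachableIn G A u u := ⟨.nil, by simpa using h⟩

lemma left_mem (h : ReachableIn G A u v) : u ∈ A := h.choose_spec _ h.choose.start_mem_support

lemma right_mem (h : ReachableIn G A u v) : v ∈ A := h.choose_spec _ h.choose.end_mem_support

lemma symm : ReachableIn G A u v → ReachableIn G A v u := fun ⟨p, hp⟩ => ⟨p.reverse, by simpa⟩

lemma trans : ReachableIn G A u v → ReachableIn G A v w → ReachableIn G A u w :=
  fun ⟨p, hp⟩ ⟨q, hq⟩ => ⟨p.append q, fun _ h =>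
    (p.mem_support_append_iff q).1 h |>.elim (hp _) (hq _)⟩

lemma mono (hAB : A ⊆ B) : ReachableIn G A u v → ReachableIn G B u v :=
  fun ⟨p, hp⟩ => ⟨p, fun _ h => hAB (hp _ h)⟩

lemma of_adj (h : G.Adj u v) (hu : u ∈ A) (hv : v ∈ A) : ReachableIn G A u v :=
  ⟨h.toWalk, by simp [hu, hv]⟩

lemma of_eq_or_adj (h : u = v ∨ G.Adj u v) (hu : u ∈ A) (hv : v ∈ A) : ReachableIn G A u v := by
  rcases h with rfl | h
  exacts [refl hu, of_adj h hu hv]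

end ReachableIn

/-- The pairs `{x (a, false), x (a, true)}` with `a ∈ K` can be joined by walks of `G` in pairwise
disjoint subsets of `A`. -/
def Linkable (G : SimpleGraph V) (A : Set V) (K : Finset κ) (x : κ × Bool → V) : Prop :=
  ∃ C : κ → Set V, (K : Set κ).PairwiseDisjoint C ∧
    ∀ a ∈ K, C a ⊆ A ∧ ReachableIn G (C a) (x (a, false)) (x (a, true))

/-- The ends `x (a, p)` of the pairs indexed by `K` are distinct vertices of `A`. -/
structure IsPairing (A : Set V) (K : Finset κ) (x : κ × Bool → V) : Prop where
  mem {e : κ × Bool} : e.1 ∈ K → x e ∈ A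
  inj {e f : κ × Bool} : e.1 ∈ K → f.1 ∈ K → x e = x f → e = f

variable {K : Finset κ} {x y : κ × Bool → V}

namespace Linkable

lemma of_card_le_one (hK : K.card ≤ 1)
    (h : ∀ a ∈ K, ReachableIn G A (x (a, false)) (x (a, true))) : Linkable G A K x :=
  ⟨fun _ => A, fun a ha b hb hab => (hab (Finset.card_le_one.1 hK a ha b hb)).elim,
    fun a ha => ⟨subset_rfl, h a ha⟩⟩

lemma of_erase [DecidableEq κ] {a : κ} {p : Bool} (hBA : B ⊆ A)
    (ha : ReachableIn G B (x (a, p)) (x (a, !p))) (hK : Linkable G (A \ B) (K.erase a) x) :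
    Linkable G A K x := by
  obtain ⟨C, hC, hCA⟩ := hK
  have hne {b : κ} (hb : b ∈ K) (hba : b ≠ a) : b ∈ K.erase a := Finset.mem_erase.2 ⟨hba, hb⟩
  have hCB {b : κ} (hb : b ∈ K) (hba : b ≠ a) : Disjoint (C b) B :=
    Set.disjoint_sdiff_left.mono_left (hCA b (hne hb hba)).1
  refine ⟨Function.update C a B, fun b hb c hc hbc => ?_, fun b hb => ?_⟩
  · rcases eq_or_ne b a with rfl | hba
    · simpa [Function.onFun, hbc.symm] using (hCB hc hbc.symm).symm
    · rcases eq_or_ne c a with rfl | hca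
      · simpa [Function.onFun, hba] using hCB hb hba
      · simpa [Function.onFun, hba, hca] using hC (hne hb hba) (hne hc hca) hbc
  · rcases eq_or_ne b a with rfl | hba
    · cases p
      · simpa [hBA] using ha
      · simpa [hBA] using ha.symm
    · simpa [hba] using
        ⟨(hCA b (hne hb hba)).1.trans Set.sdiff_subset, (hCA b (hne hb hba)).2⟩

lemma of_near (hx : IsPairing B K x) (hAB : A ⊆ B) (hy : Linkable G A K y)
    (hxy : ∀ e, e.1 ∈ K → x e = y e ∨ x e ∉ A ∧ G.Adj (x e) (y e)) : Linkable G B K x := by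
  obtain ⟨C, hC, hCA⟩ := hy
  have hyC {e : κ × Bool} (he : e.1 ∈ K) : y e ∈ C e.1 := by
    obtain ⟨a, _ | _⟩ := e
    exacts [(hCA a he).2.left_mem, (hCA a he).2.right_mem]
  have hxC {e : κ × Bool} {a : κ} (he : e.1 ∈ K) (ha : a ∈ K) (h : x e ∈ C a) : e.1 = a := by
    rcases hxy e he with heq | ⟨hA, -⟩
    · exact hC.elim he ha (Set.not_disjoint_iff.2 ⟨x e, heq ▸ hyC he, h⟩)
    · exact (hA ((hCA a ha).1 h)).elim
  refine ⟨fun a => C a ∪ Set.range fun p => x (a, p), fun a ha b hb hab => ?_, fun a ha => ⟨?_, ?_⟩⟩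
  · rw [Function.onFun, Set.disjoint_left]
    rintro _ (hv | ⟨p, rfl⟩) (hw | ⟨q, hq⟩)
    · exact Set.disjoint_left.1 (hC ha hb hab) hv hw
    · exact hab (hxC (e := (b, q)) hb ha (Set.mem_of_eq_of_mem hq hv)).symm
    · exact hab (hxC (e := (a, p)) ha hb hw)
    · exact hab (congrArg Prod.fst (hx.inj (e := (b, q)) (f := (a, p)) hb ha hq)).symm
  · exact Set.union_subset ((hCA a ha).1.trans hAB) (Set.range_subset_iff.2 fun p => hx.mem ha)
  · have hend (p : Bool) :
        ReachableIn G (C a ∪ Set.range fun p => x (a, p)) (x (a, p)) (y (a, p)) :=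
      .of_eq_or_adj ((hxy (a, p) ha).imp_right And.right) (.inr ⟨p, rfl⟩)
        (.inl (hyC (e := (a, p)) ha))
    exact (hend false).trans (((hCA a ha).2.mono Set.subset_union_left).trans (hend true).symm)

end Linkable

lemma isKLinked_of_forall_linkable {k : ℕ} (hk : ((2 * k : ℕ) : ℕ∞) ≤ ENat.card V)
    (h : ∀ x : Fin k × Bool → V, Function.Injective x → Linkable G Set.univ Finset.univ x) :
    G.IsKLinked k := by
  classical
  refine ⟨hk, fun s t hst => ?_⟩
  have hinj : Function.Injective fun e : Fin k × Bool => Sum.elim s t (bif e.2 then .inr e.1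
      else .inl e.1) := hst.comp <| by
    rintro ⟨a, _ | _⟩ ⟨b, _ | _⟩ hab <;> simp_all
  obtain ⟨C, hC, hCA⟩ := h _ hinj
  choose p hp using fun a => (hCA a (Finset.mem_univ a)).2
  refine ⟨fun a => (p a).toPath, fun a b hab v hva hvb => ?_⟩
  exact Set.disjoint_left.1 (hC (by simp) (by simp) hab)
    (hp a v ((p a).support_bypass_subset_support hva))
    (hp b v ((p b).support_bypass_subset_support hvb))

lemma isKLinked_of_bijective_hom {H : SimpleGraph W} {k : ℕ} (f : G →g H)
    (hf : Function.Bijective f) (hG : G.IsKLinked k) : H.IsKLinked k := by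
  refine ⟨hG.1.trans (ENat.card_le_card_of_injective hf.1), fun s t hst => ?_⟩
  obtain ⟨s, rfl⟩ := hf.surjective.comp_left s
  obtain ⟨t, rfl⟩ := hf.surjective.comp_left t
  obtain ⟨L, hL⟩ := hG.2 s t (.of_comp (f := f) (by rwa [Sum.comp_elim]))
  refine ⟨fun i => (L i).map f hf.injective, fun i j hij v hvi hvj => ?_⟩
  obtain ⟨v, hv, rfl⟩ := List.mem_map.1 (SimpleGraph.Walk.support_map f (L i).1 ▸ hvi)
  exact hL i j hij hv
    ((List.mem_map_of_injective hf.injective).1 (SimpleGraph.Walk.support_map f (L j).1 ▸ hvj))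

section Obstacles

variable {Z : Finset V} {a : κ} {e : κ × Bool}

lemma IsPairing.end_ne_end_not (hx : IsPairing A K x) (ha : a ∈ K) (p : Bool) :
    x (a, p) ≠ x (a, !p) := fun h => by
  simpa using hx.inj (e := (a, p)) (f := (a, !p)) ha ha h

lemma IsPairing.ne_of_mem_erase [DecidableEq κ] (hx : IsPairing A K x) (ha : a ∈ K) (p : Bool)
    (he : e.1 ∈ K.erase a) : x e ≠ x (a, p) := fun h =>
  Finset.ne_of_mem_erase he (congrArg Prod.fst
    (hx.inj (f := (a, p)) (Finset.mem_of_mem_erase he) ha h))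

variable [DecidableEq V]

/-- The vertices to be avoided by a walk that has to be disjoint from the set `Z` and from the
pairs indexed by `K`. -/
def obstacles (K : Finset κ) (x : κ × Bool → V) (Z : Finset V) : Finset V :=
  (K ×ˢ Finset.univ).image x ∪ Z

lemma mem_obstacles : v ∈ obstacles K x Z ↔ (∃ e : κ × Bool, e.1 ∈ K ∧ x e = v) ∨ v ∈ Z := by
  simp [obstacles]

lemma end_mem_obstacles (he : e.1 ∈ K) : x e ∈ obstacles K x Z :=
  mem_obstacles.2 (.inl ⟨e, he, rfl⟩)

lemma subset_obstacles : Z ⊆ obstacles K x Z := Finset.subset_union_right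

lemma card_obstacles_le (K : Finset κ) (x : κ × Bool → V) (Z : Finset V) :
    (obstacles K x Z).card ≤ 2 * K.card + Z.card := by
  have himage := Finset.card_image_le (s := K ×ˢ (Finset.univ : Finset Bool)) (f := x)
  rw [Finset.card_product, Finset.card_univ, Fintype.card_bool, mul_comm] at himage
  exact (Finset.card_union_le _ _).trans (Nat.add_le_add_right himage _)

variable [DecidableEq κ]

lemma obstacles_erase_subset : obstacles (K.erase a) x Z ⊆ obstacles K x Z := fun _ hv =>
  mem_obstacles.2 <| (mem_obstacles.1 hv).imp_left fun ⟨e, he, h⟩ =>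
    ⟨e, Finset.mem_of_mem_erase he, h⟩

lemma insert_obstacles_erase_subset (ha : a ∈ K) (p : Bool) :
    insert (x (a, p)) (obstacles (K.erase a) x Z) ⊆ obstacles K x Z :=
  Finset.insert_subset (end_mem_obstacles (e := (a, p)) ha) obstacles_erase_subset

lemma mem_obstacles_erase_or (hv : v ∈ obstacles K x Z) (a : κ) (p : Bool) :
    v ∈ obstacles (K.erase a) x Z ∨ v = x (a, p) ∨ v = x (a, !p) := by
  rcases mem_obstacles.1 hv with ⟨⟨b, q⟩, hb, rfl⟩ | hvZ
  · rcases eq_or_ne b a with rfl | hba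
    · cases p <;> cases q <;> simp
    · exact .inl (end_mem_obstacles (Finset.mem_erase.2 ⟨hba, hb⟩))
  · exact .inl (subset_obstacles hvZ)

lemma card_obstacles_erase_add_two_le (ha : a ∈ K) (x : κ × Bool → V) (Z : Finset V) :
    (obstacles (K.erase a) x Z).card + 2 ≤ 2 * K.card + Z.card := by
  have hle := card_obstacles_le (K.erase a) x Z
  have hK := Finset.card_erase_add_one ha
  omega

lemma IsPairing.end_notMem_obstacles_erase (hx : IsPairing (A \ Z) K x) (ha : a ∈ K) (p : Bool) :
    x (a, p) ∉ obstacles (K.erase a) x Z := fun h => by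
  rcases mem_obstacles.1 h with ⟨e, he, h⟩ | h
  · exact hx.ne_of_mem_erase ha p he h
  · exact (hx.mem (e := (a, p)) ha).2 h

end Obstacles

end Linkable

section Toggle

variable {ι : Type*} [DecidableEq ι] {i j l : ι} {u v : ι → Bool} {b : Bool}

/-- The vertex of the cube obtained from `v` by changing its `i`-th coordinate. -/
def toggle (i : ι) (v : ι → Bool) : ι → Bool := Function.update v i (!v i)

@[simp] lemma toggle_same (i : ι) (v : ι → Bool) : toggle i v i = !v i := by simp [toggle]

@[simp] lemma toggle_of_ne (h : j ≠ i) (v : ι → Bool) : toggle i v j = v j := by simp [toggle, h]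

@[simp] lemma toggle_toggle (i : ι) (v : ι → Bool) : toggle i (toggle i v) = v := by simp [toggle]

lemma toggle_ne_self (i : ι) (v : ι → Bool) : toggle i v ≠ v := fun h => by
  simpa using congrFun h i

lemma toggle_injective (i : ι) : Function.Injective (toggle i) :=
  Function.LeftInverse.injective (g := toggle i) (toggle_toggle i)

lemma toggle_eq_comm : toggle i u = v ↔ toggle i v = u := by
  constructor <;> rintro rfl <;> exact toggle_toggle _ _

lemma toggle_left_injective (v : ι → Bool) : Function.Injective (toggle · v) := fun i j h => by
  by_contra hij
  simpa [hij] using congrFun h i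

lemma toggle_toggle_ne_toggle (h : l ≠ j) (m : ι) (u : ι → Bool) :
    toggle l (toggle j u) ≠ toggle m u := fun e => by
  have hl : l = m := by_contra fun hm => by simpa [h, hm] using congrFun e l
  have hj : j = m := by_contra fun hm => by simpa [h.symm, hm] using congrFun e j
  exact h (hl.trans hj.symm)

lemma update_eq_toggle (h : v i ≠ b) : Function.update v i b = toggle i v := by
  rw [toggle, Bool.not_eq.2 h]

lemma update_eq_or_eq_toggle (i : ι) (v : ι → Bool) (b : Bool) :
    Function.update v i b = v ∨ Function.update v i b = toggle i v :=
  (eq_or_ne (v i) b).imp (fun h => Function.update_eq_self_iff.2 h.symm) update_eq_toggle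

lemma eq_or_eq_toggle_of_update_eq (h : Function.update u i b = Function.update v i b) :
    u = v ∨ u = toggle i v := by
  have h' : Function.update v i (u i) = u := by
    rw [← Function.update_idem b, ← h, Function.update_idem, Function.update_eq_self]
  exact h' ▸ update_eq_or_eq_toggle i v (u i)

/-- The graph of the cube with vertex set `ι → Bool`: two vertices are adjacent if they differ in
exactly one coordinate. -/
def cubeGraph (ι : Type*) [DecidableEq ι] : SimpleGraph (ι → Bool) where
  Adj u v := ∃ i, toggle i u = v
  symm := ⟨fun _ _ ⟨i, h⟩ => ⟨i, toggle_eq_comm.1 h⟩⟩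
  loopless := ⟨fun _ ⟨i, h⟩ => toggle_ne_self i _ h⟩

lemma ReachableIn.toggle {A : Set (ι → Bool)} (hv : v ∈ A) (hi : toggle i v ∈ A) :
    ReachableIn (cubeGraph ι) A v (toggle i v) := .of_adj ⟨i, rfl⟩ hv hi

end Toggle

section Face

variable {ι : Type*} {I : Finset ι} {c v : ι → Bool} {i : ι} {b : Bool}

/-- The vertex set of the face of the cube through `c` spanned by the directions in `I`. -/
def face (I : Finset ι) (c : ι → Bool) : Set (ι → Bool) := {v | ∀ j ∉ I, v j = c j}

lemma card_filter_add_card_filter_not (Y : Finset (ι → Bool)) (i : ι) (b : Bool) :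
    (Y.filter (· i = b)).card + (Y.filter (· i = !b)).card = Y.card := by
  simpa only [← Bool.eq_not] using Finset.card_filter_add_card_filter_not (s := Y) (· i = b)

variable [DecidableEq ι]

/-- For `i ∈ I`, the facet of `face I c` on which the `i`-th coordinate is `b`. It is written as a
face, so that statements about all faces apply to it. -/
abbrev facet (I : Finset ι) (c : ι → Bool) (i : ι) (b : Bool) : Set (ι → Bool) :=
  face (I.erase i) (Function.update c i b)

lemma mem_facet (hi : i ∈ I) : v ∈ facet I c i b ↔ v ∈ face I c ∧ v i = b := by
  refine ⟨fun h => ⟨fun j hj => ?_, by simpa using h i (by simp)⟩, fun ⟨h, hb⟩ j hj => ?_⟩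
  · simpa [ne_of_mem_of_not_mem hi hj |>.symm] using h j fun h' => hj (Finset.mem_of_mem_erase h')
  · rcases eq_or_ne j i with rfl | hji
    · simpa using hb
    · simpa [hji] using h j fun h' => hj (Finset.mem_erase.2 ⟨hji, h'⟩)

lemma mem_facet_diff {A : Set (ι → Bool)} (hi : i ∈ I) (hv : v ∈ face I c \ A) (hb : v i = b) :
    v ∈ facet I c i b \ A := ⟨(mem_facet hi).2 ⟨hv.1, hb⟩, hv.2⟩

lemma facet_subset (hi : i ∈ I) (b : Bool) : facet I c i b ⊆ face I c :=
  fun _ h => ((mem_facet hi).1 h).1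

lemma update_mem_facet (hi : i ∈ I) (hv : v ∈ face I c) (b : Bool) :
    Function.update v i b ∈ facet I c i b :=
  (mem_facet hi).2 ⟨fun j hj => by
    rw [Function.update_of_ne (ne_of_mem_of_not_mem hi hj).symm, hv j hj], by simp⟩

lemma toggle_mem_face (hi : i ∈ I) (hv : v ∈ face I c) : toggle i v ∈ face I c :=
  facet_subset hi _ (update_mem_facet hi hv _)

lemma facet_diff_filter (hi : i ∈ I) (Y : Finset (ι → Bool)) :
    facet I c i b \ (Y.filter (· i = b)) = facet I c i b \ Y := by
  ext v
  simp +contextual [mem_facet hi]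

end Face

section Connectivity

variable {ι : Type*} [DecidableEq ι] {J : Finset ι} {c s t u : ι → Bool} {Y : Finset (ι → Bool)}
  {j : ι} {b : Bool}

lemma exists_reachableIn_opposite (hj : j ∈ J) (hY : Y.card < J.card) (hu : u ∈ face J c)
    (huY : u ∉ Y) : ∃ v, v j = (!u j) ∧ ReachableIn (cubeGraph ι) (face J c \ Y) u v := by
  classical
  -- The edges of direction `j` at the points of `N` are more than `#Y`, so one of them avoids `Y`.
  let N : Finset (ι → Bool) := insert u ((J.erase j).image (toggle · u))
  have hN : (Y.image (Function.update · j (u j))).card < N.card := by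
    rw [Finset.card_insert_of_notMem (by simp [toggle_ne_self]),
      Finset.card_image_of_injective _ (toggle_left_injective u), Finset.card_erase_add_one hj]
    exact Finset.card_image_le.trans_lt hY
  obtain ⟨w, hwN, hwY⟩ := Finset.exists_mem_notMem_of_card_lt_card hN
  obtain ⟨hwj, hw, hadj⟩ : w j = u j ∧ w ∈ face J c ∧ (u = w ∨ (cubeGraph ι).Adj u w) := by
    obtain rfl | hwN := Finset.mem_insert.1 hwN
    · exact ⟨rfl, hu, .inl rfl⟩
    · obtain ⟨l, hl, rfl⟩ := Finset.mem_image.1 hwN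
      obtain ⟨hlj, hl⟩ := Finset.mem_erase.1 hl
      exact ⟨toggle_of_ne hlj.symm u, toggle_mem_face hl hu, .inr ⟨l, rfl⟩⟩
  have hw_notMem : w ∉ Y := fun h => hwY (Finset.mem_image.2 ⟨w, h, by simp [← hwj]⟩)
  have htoggle_notMem : toggle j w ∉ Y := fun h =>
    hwY (Finset.mem_image.2 ⟨toggle j w, h, by simp [toggle, ← hwj]⟩)
  have huw : ReachableIn (cubeGraph ι) (face J c \ Y) u w :=
    .of_eq_or_adj hadj ⟨hu, huY⟩ ⟨hw, hw_notMem⟩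
  exact ⟨toggle j w, by simp [hwj],
    huw.trans (.toggle huw.right_mem ⟨toggle_mem_face hj hw, htoggle_notMem⟩)⟩

lemma reachableIn_face_diff (hY : Y.card ≤ J.card - 1) (hs : s ∈ face J c \ Y)
    (ht : t ∈ face J c \ Y) : ReachableIn (cubeGraph ι) (face J c \ Y) s t := by
  induction hn : J.card generalizing J c s t Y with
  | zero =>
    obtain rfl := Finset.card_eq_zero.1 hn
    obtain rfl : s = t := funext fun j => (hs.1 j (by simp)).trans (ht.1 j (by simp)).symm
    exact .refl hs
  | succ n ih =>
    obtain ⟨j, hj⟩ : J.Nonempty := Finset.card_pos.1 (by omega)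
    have hJ : (J.erase j).card = n := by rw [Finset.card_erase_of_mem hj, hn, Nat.add_sub_cancel]
    obtain ⟨b, hb⟩ : ∃ b, (Y.filter (· j = b)).card ≤ n - 1 := by
      have hsum := card_filter_add_card_filter_not Y j true
      by_contra! hcon
      have htrue := hcon true
      have hfalse := hcon false
      simp only [Bool.not_true] at hsum
      omega
    have hside (u) (hu : u ∈ face J c \ Y) :
        ∃ v, v j = b ∧ ReachableIn (cubeGraph ι) (face J c \ Y) u v := by
      by_cases hub : u j = b
      · exact ⟨u, hub, .refl hu⟩
      · rw [← Bool.not_eq.2 hub]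
        exact exists_reachableIn_opposite hj (by omega) hu.1 hu.2
    obtain ⟨s', hs'b, hs'⟩ := hside s hs
    obtain ⟨t', ht'b, ht'⟩ := hside t ht
    have hst' : ReachableIn (cubeGraph ι) (facet J c j b \ Y) s' t' := by
      have hs'_mem := mem_facet_diff hj hs'.right_mem hs'b
      have ht'_mem := mem_facet_diff hj ht'.right_mem ht'b
      rw [← facet_diff_filter hj] at hs'_mem ht'_mem ⊢
      exact ih (by rwa [hJ]) hs'_mem ht'_mem hJ
    exact hs'.trans
      ((hst'.mono (Set.sdiff_subset_sdiff_left (facet_subset hj b))).trans ht'.symm)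

lemma reachableIn_facet_diff (hj : j ∈ J) (hY : (Y.filter (· j = b)).card ≤ J.card - 2)
    (hs : s ∈ facet J c j b \ Y) (ht : t ∈ facet J c j b \ Y) :
    ReachableIn (cubeGraph ι) (facet J c j b \ Y) s t := by
  rw [← facet_diff_filter hj] at hs ht ⊢
  exact reachableIn_face_diff (by rw [Finset.card_erase_of_mem hj]; omega) hs ht

lemma reachableIn_face_diff_of_not_isolated (hJ : 3 ≤ J.card) (hY : Y.card ≤ J.card)
    (hs : s ∈ face J c \ Y) (ht : t ∈ face J c \ Y) (hs' : ∃ l ∈ J, toggle l s ∉ Y)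
    (ht' : ∃ l ∈ J, toggle l t ∉ Y) : ReachableIn (cubeGraph ι) (face J c \ Y) s t := by
  obtain ⟨j, hj, hjs⟩ := hs'
  obtain ⟨l, hl, hlt⟩ := ht'
  have hside (b : Bool) : ∃ s', s' j = b ∧ ReachableIn (cubeGraph ι) (face J c \ Y) s s' := by
    by_cases hb : s j = b
    · exact ⟨s, hb, .refl hs⟩
    · exact ⟨toggle j s, by rwa [toggle_same, Bool.not_eq],
        .toggle hs ⟨toggle_mem_face hj hs.1, hjs⟩⟩
  suffices h : ∃ t', (Y.filter (· j = t' j)).card ≤ J.card - 2 ∧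
      ReachableIn (cubeGraph ι) (face J c \ Y) t t' by
    obtain ⟨t', hcard, htt'⟩ := h
    obtain ⟨s', hs'j, hss'⟩ := hside (t' j)
    have hst' := reachableIn_facet_diff (c := c) hj hcard
      (mem_facet_diff hj hss'.right_mem hs'j) (mem_facet_diff hj htt'.right_mem rfl)
    exact hss'.trans
      ((hst'.mono (Set.sdiff_subset_sdiff_left (facet_subset hj _))).trans htt'.symm)
  by_cases hsame : (Y.filter (· j = t j)).card ≤ J.card - 2
  · exact ⟨t, hsame, .refl ht⟩
  have hopp : (Y.filter (· j = !t j)).card ≤ 1 := by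
    have hsum := card_filter_add_card_filter_not Y j (t j)
    omega
  by_cases hjt : toggle j t ∈ Y
  · have hlj : j ≠ l := by rintro rfl; exact hlt hjt
    have htl : toggle l t ∈ face J c \ Y := ⟨toggle_mem_face hl ht.1, hlt⟩
    refine ⟨toggle j (toggle l t), ?_, (ReachableIn.toggle ht htl).trans
      (.toggle htl ⟨toggle_mem_face hj htl.1, fun hjl => ?_⟩)⟩
    · rw [toggle_same, toggle_of_ne hlj]
      omega
    · exact toggle_ne_self l t (toggle_injective j (Finset.card_le_one.1 hopp _
        (Finset.mem_filter.2 ⟨hjl, by simp [hlj]⟩) _ (Finset.mem_filter.2 ⟨hjt, by simp⟩)))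
  · exact ⟨toggle j t, by rw [toggle_same]; omega, .toggle ht ⟨toggle_mem_face hj ht.1, hjt⟩⟩

lemma exists_toggle_toggle_notMem_nhd (hJ : 3 ≤ J.card) (j : ι) (u w : ι → Bool) :
    ∃ l ∈ J, toggle l (toggle j u) ≠ u ∧ toggle l (toggle j u) ≠ w ∧
      ∀ m, toggle l (toggle j u) ≠ toggle m u := by
  have hcard : 1 < (J.erase j).card := by
    have := Finset.pred_card_le_card_erase (s := J) (a := j)
    omega
  obtain ⟨l, hl, l', hl', hne⟩ := Finset.one_lt_card.1 hcard
  obtain ⟨m, hm, hmw⟩ : ∃ m ∈ J.erase j, toggle m (toggle j u) ≠ w := by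
    by_cases h : toggle l (toggle j u) = w
    · exact ⟨l', hl', fun h' => hne (toggle_left_injective _ (h.trans h'.symm))⟩
    · exact ⟨l, hl, h⟩
  obtain ⟨hmj, hm⟩ := Finset.mem_erase.1 hm
  exact ⟨m, hm, fun h => hmj (toggle_left_injective u (toggle_eq_comm.1 h)), hmw,
    fun l => toggle_toggle_ne_toggle hmj l u⟩

end Connectivity

section Directions

variable {ι : Type*} [DecidableEq ι] [DecidableEq (ι → Bool)] {X : Finset (ι → Bool)}
  {I : Finset ι} {i j : ι} {u v : ι → Bool}

/-- The edges of direction `i` with both ends in `X`, each recorded by its end with `i`-th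
coordinate `true`. -/
def directionEdges (i : ι) (X : Finset (ι → Bool)) : Finset (ι → Bool) :=
  X.filter fun u => u i = true ∧ toggle i u ∈ X

lemma update_mem_directionEdges (hu : u ∈ X) (hiu : toggle i u ∈ X) :
    Function.update u i true ∈ directionEdges i X := by
  rcases h : u i
  · rw [update_eq_toggle (by simp [h])]
    simp [directionEdges, *]
  · rw [Function.update_eq_self_iff.2 h.symm]
    simp [directionEdges, *]

lemma eq_or_eq_toggle_of_card_directionEdges_le_one (hX : (directionEdges i X).card ≤ 1)
    (hu : u ∈ X) (hiu : toggle i u ∈ X) (hv : v ∈ X) (hiv : toggle i v ∈ X) :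
    v = u ∨ v = toggle i u :=
  eq_or_eq_toggle_of_update_eq <| Finset.card_le_one.1 hX _ (update_mem_directionEdges hv hiv) _
    (update_mem_directionEdges hu hiu)

lemma card_image_update_add_card_directionEdges_le (i : ι) (X : Finset (ι → Bool)) :
    (X.image (Function.update · i false)).card + (directionEdges i X).card ≤ X.card := by
  have himage : X.image (Function.update · i false) ⊆
      (X \ directionEdges i X).image (Function.update · i false) := by
    refine Finset.image_subset_iff.2 fun u hu => Finset.mem_image.2 ?_
    by_cases hE : u ∈ directionEdges i X
    · obtain ⟨-, hui, hiu⟩ := Finset.mem_filter.1 hE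
      exact ⟨toggle i u, Finset.mem_sdiff.2 ⟨hiu, by simp [directionEdges, hui]⟩, by simp [toggle]⟩
    · exact ⟨u, Finset.mem_sdiff.2 ⟨hu, hE⟩, rfl⟩
  calc
    _ ≤ (X \ directionEdges i X).card + (directionEdges i X).card :=
      Nat.add_le_add_right ((Finset.card_le_card himage).trans Finset.card_image_le) _
    _ = X.card := Finset.card_sdiff_add_card_eq_card (Finset.filter_subset _ _)

lemma exists_edge_image_update (hij : i ≠ j) (h : ∃ u ∈ X, toggle j u ∈ X) :
    ∃ u ∈ X.image (Function.update · i false),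
      toggle j u ∈ X.image (Function.update · i false) := by
  obtain ⟨u, hu, hju⟩ := h
  refine ⟨_, Finset.mem_image_of_mem _ hu, Finset.mem_image.2 ⟨_, hju, ?_⟩⟩
  simp [toggle, hij.symm, Function.update_comm hij]

omit [DecidableEq (ι → Bool)] in
lemma card_lt_card_of_forall_exists_edge (hX : X.Nonempty)
    (h : ∀ i ∈ I, ∃ u ∈ X, toggle i u ∈ X) : I.card < X.card := by
  classical
  induction I using Finset.induction_on generalizing X with
  | empty => exact hX.card_pos
  | insert i I hi ih =>
    obtain ⟨u, hu, hiu⟩ := h i (Finset.mem_insert_self i I)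
    have hedge := Finset.card_pos.2 ⟨_, update_mem_directionEdges hu hiu⟩
    have hle := card_image_update_add_card_directionEdges_le i X
    have hlt := ih (hX.image (Function.update · i false)) fun j hj =>
      exists_edge_image_update (ne_of_mem_of_not_mem hj hi).symm
        (h j (Finset.mem_insert_of_mem hj))
    rw [Finset.card_insert_of_notMem hi]
    omega

lemma exists_card_directionEdges_le_one (hI : I.Nonempty) (hX : X.card ≤ I.card + 1) :
    ∃ i ∈ I, (directionEdges i X).card ≤ 1 := by
  by_contra! hcon
  have hedge (i) (hi : i ∈ I) : ∃ u ∈ X, toggle i u ∈ X := by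
    obtain ⟨u, hu⟩ := Finset.card_pos.1 (zero_lt_one.trans (hcon i hi))
    exact ⟨u, (Finset.mem_filter.1 hu).1, (Finset.mem_filter.1 hu).2.2⟩
  obtain ⟨i, hi⟩ := hI
  obtain ⟨u, hu, -⟩ := hedge i hi
  have htwo := hcon i hi
  have hle := card_image_update_add_card_directionEdges_le i X
  have hlt := card_lt_card_of_forall_exists_edge (I := I.erase i)
    (Finset.Nonempty.image ⟨u, hu⟩ (Function.update · i false)) fun j hj =>
      exists_edge_image_update (Finset.ne_of_mem_erase hj).symm
        (hedge j (Finset.mem_of_mem_erase hj))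
  rw [Finset.card_erase_of_mem hi] at hlt
  omega

end Directions

section Splitting

variable {ι κ : Type*} [DecidableEq ι] [DecidableEq (ι → Bool)] [DecidableEq κ] {I J : Finset ι}
  {c v : ι → Bool} {i : ι} {K : Finset κ} {x : κ × Bool → ι → Bool} {Z : Finset (ι → Bool)}
  {a : κ} {p : Bool}

/-- The pair `a` can be joined in the facet orthogonal to the direction `i` that contains its end
`x (a, p)`, up to a last step from the other end into that facet, while all other pairs can be
moved to the opposite facet along `i`. -/
structure IsSplitting (I : Finset ι) (c : ι → Bool) (K : Finset κ) (x : κ × Bool → ι → Bool)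
    (Z : Finset (ι → Bool)) (i : ι) (a : κ) (p : Bool) : Prop where
  reach : ReachableIn (cubeGraph ι) (facet I c i (x (a, p) i) \ obstacles (K.erase a) x Z)
    (x (a, p)) (Function.update (x (a, !p)) i (x (a, p) i))
  free {e : κ × Bool} : e.1 ∈ K.erase a →
    toggle i (x e) ∉ insert (x (a, !p)) (obstacles (K.erase a) x Z)

namespace IsSplitting

lemma isPairing_update (hs : IsSplitting I c K x Z i a p) (hi : i ∈ I) (ha : a ∈ K)
    (hx : IsPairing (face I c \ Z) K x) (b : Bool) :
    IsPairing (facet I c i b \ ↑(insert (x (a, !p)) Z)) (K.erase a)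
      (fun e => Function.update (x e) i b) where
  mem {e} he := by
    have heK := Finset.mem_of_mem_erase he
    refine ⟨update_mem_facet hi (hx.mem heK).1 b, fun hmem => ?_⟩
    rw [Finset.mem_coe] at hmem
    rcases update_eq_or_eq_toggle i (x e) b with h | h <;> rw [h] at hmem
    · rcases Finset.mem_insert.1 hmem with h | h
      · exact hx.ne_of_mem_erase ha (!p) he h
      · exact (hx.mem heK).2 h
    · exact hs.free he (Finset.insert_subset_insert _ subset_obstacles hmem)
  inj {e f} he hf hef := by
    rcases eq_or_eq_toggle_of_update_eq hef with h | h
    · exact hx.inj (Finset.mem_of_mem_erase he) (Finset.mem_of_mem_erase hf) h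
    · exact (hs.free hf (h ▸ Finset.mem_insert_of_mem (end_mem_obstacles he))).elim

lemma linkable (hs : IsSplitting I c K x Z i a p) (hi : i ∈ I) (ha : a ∈ K)
    (hx : IsPairing (face I c \ Z) K x)
    (hK : Linkable (cubeGraph ι) (facet I c i (!x (a, p) i) \ ↑(insert (x (a, !p)) Z)) (K.erase a)
      fun e => Function.update (x e) i (!x (a, p) i)) :
    Linkable (cubeGraph ι) (face I c \ Z) K x := by
  set b := x (a, p) i
  let B : Set (ι → Bool) := insert (x (a, !p)) (facet I c i b \ obstacles (K.erase a) x Z)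
  have hB : B ⊆ face I c \ Z := Set.insert_subset (hx.mem ha) fun v hv =>
    ⟨facet_subset hi b hv.1, fun h => hv.2 (subset_obstacles h)⟩
  have hreach : ReachableIn (cubeGraph ι) B (x (a, p)) (x (a, !p)) := by
    have hreach := hs.reach.mono (Set.subset_insert (x (a, !p)) _)
    refine hreach.trans (ReachableIn.of_eq_or_adj ?_ (Set.mem_insert _ _) hreach.right_mem).symm
    exact (update_eq_or_eq_toggle i (x (a, !p)) b).imp Eq.symm fun h => ⟨i, h.symm⟩
  have hx_erase : IsPairing ((face I c \ Z) \ B) (K.erase a) x :=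
    { mem := fun {e} he => by
        refine ⟨hx.mem (Finset.mem_of_mem_erase he), ?_⟩
        rintro (h | h)
        · exact hx.ne_of_mem_erase ha (!p) he h
        · exact h.2 (end_mem_obstacles he)
      inj := fun he hf =>
        hx.inj (Finset.mem_of_mem_erase he) (Finset.mem_of_mem_erase hf) }
  refine .of_erase hB hreach (.of_near hx_erase ?_ hK fun e _ => ?_)
  · intro v hv
    obtain ⟨hvI, hvi⟩ := (mem_facet hi).1 hv.1
    obtain ⟨hva, hvZ⟩ := not_or.1 (Finset.mem_insert.not.1 hv.2)
    refine ⟨⟨hvI, hvZ⟩, ?_⟩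
    rintro (h | h)
    · exact hva h
    · simpa [hvi] using ((mem_facet hi).1 h.1).2
  · refine (eq_or_ne (x e i) (!b)).imp (fun h => (Function.update_eq_self_iff.2 h.symm).symm)
      fun h => ⟨fun hmem => h ((mem_facet hi).1 hmem.1).2, i, (update_eq_toggle h).symm⟩

end IsSplitting

lemma reachableIn_update_of_mem_obstacles (hi : i ∈ I) (ha : a ∈ K)
    (hx : IsPairing (face I c \ Z) K x) (hcard : 2 * K.card + Z.card ≤ I.card + 1)
    (hv : v ∈ obstacles (K.erase a) x Z) (hvi : v i ≠ x (a, p) i)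
    (hend : Function.update (x (a, !p)) i (x (a, p) i) ∉ obstacles (K.erase a) x Z) :
    ReachableIn (cubeGraph ι) (facet I c i (x (a, p) i) \ obstacles (K.erase a) x Z)
      (x (a, p)) (Function.update (x (a, !p)) i (x (a, p) i)) := by
  refine reachableIn_facet_diff hi ?_
    (mem_facet_diff hi ⟨(hx.mem ha).1, hx.end_notMem_obstacles_erase ha p⟩ rfl)
    ⟨update_mem_facet hi (hx.mem ha).1 _, hend⟩
  have hlt := Finset.card_lt_card (Finset.filter_ssubset (p := (· i = x (a, p) i)).2 ⟨v, hv, hvi⟩)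
  have hle := card_obstacles_erase_add_two_le ha x Z
  omega

lemma isSplitting_of_toggle_mem_obstacles (hi : i ∈ I) (ha : a ∈ K)
    (hx : IsPairing (face I c \ Z) K x) (hcard : 2 * K.card + Z.card ≤ I.card + 1)
    (hedges : (directionEdges i (obstacles K x Z)).card ≤ 1)
    (hai : toggle i (x (a, p)) ∈ obstacles K x Z) : IsSplitting I c K x Z i a p := by
  have hunique {v : ι → Bool} (hv : v ∈ obstacles K x Z) (hiv : toggle i v ∈ obstacles K x Z) :
      v = x (a, p) ∨ toggle i v = x (a, p) :=
    (eq_or_eq_toggle_of_card_directionEdges_le_one hedges (end_mem_obstacles (e := (a, p)) ha)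
      hai hv hiv).imp_right fun h => (toggle_eq_comm.1 h.symm)
  have hap := hx.end_notMem_obstacles_erase ha p
  have hap' := hx.end_notMem_obstacles_erase ha (!p)
  have hne := hx.end_ne_end_not ha p
  refine ⟨?_, fun {e} he hmem => ?_⟩
  · rcases mem_obstacles_erase_or hai a p with h | h | h
    · refine reachableIn_update_of_mem_obstacles hi ha hx hcard h (by simp) fun hmem => ?_
      rcases update_eq_or_eq_toggle i (x (a, !p)) (x (a, p) i) with heq | heq <;> rw [heq] at hmem
      · exact hap' hmem
      · rcases hunique (end_mem_obstacles (e := (a, !p)) ha)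
          (obstacles_erase_subset hmem) with h | h
        · exact hne h.symm
        · exact hap (h ▸ hmem)
    · exact (toggle_ne_self i _ h).elim
    · rw [← h, toggle, Function.update_idem, Function.update_eq_self]
      exact .refl (mem_facet_diff hi ⟨(hx.mem ha).1, hap⟩ rfl)
  · rcases hunique (end_mem_obstacles (Finset.mem_of_mem_erase he))
      (insert_obstacles_erase_subset ha (!p) hmem) with h | h
    · exact hx.ne_of_mem_erase ha p he h
    · rw [h] at hmem
      exact (Finset.mem_insert.1 hmem).elim hne hap

lemma exists_forall_toggle_notMem_obstacles (hK : 2 ≤ K.card) (hJ : 3 ≤ J.card)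
    (hcard : 2 * K.card + Z.card ≤ J.card + 2) :
    ∃ a ∈ K, ∀ p, ∃ l ∈ J, toggle l (x (a, p)) ∉ obstacles (K.erase a) x Z := by
  by_contra! hcon
  obtain ⟨a, ha, b, hb, hab⟩ := Finset.one_lt_card.1 hK
  obtain ⟨p, hp⟩ := hcon a ha
  obtain ⟨q, hq⟩ := hcon b hb
  -- By the count of obstacles, those that isolate `x (a, p)` are all of them. Now `x (b, q)` is one
  -- of its neighbours and is isolated as well, so some obstacle has distance two from `x (a, p)`.
  have hnhd : J.image (toggle · (x (a, p))) = obstacles (K.erase a) x Z := by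
    refine Finset.eq_of_subset_of_card_le (Finset.image_subset_iff.2 hp) ?_
    have hle := card_obstacles_erase_add_two_le ha x Z
    rw [Finset.card_image_of_injective _ (toggle_left_injective _)]
    omega
  have hbq : x (b, q) ∈ J.image (toggle · (x (a, p))) :=
    hnhd ▸ end_mem_obstacles (e := (b, q)) (Finset.mem_erase.2 ⟨hab.symm, hb⟩)
  obtain ⟨j, -, hj⟩ := Finset.mem_image.1 hbq
  obtain ⟨l, hl, hne, hne', hfar⟩ :=
    exists_toggle_toggle_notMem_nhd hJ j (x (a, p)) (x (a, !p))
  have hmem := obstacles_erase_subset (hq l hl)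
  rw [← hj] at hmem
  rcases mem_obstacles_erase_or hmem a p with h | h | h
  · obtain ⟨m, -, hm⟩ := Finset.mem_image.1 (hnhd ▸ h)
    exact hfar m hm.symm
  · exact hne h
  · exact hne' h

lemma exists_isSplitting_of_forall_toggle_notMem (hi : i ∈ I) (hx : IsPairing (face I c \ Z) K x)
    (hK : 2 ≤ K.card) (hI : 4 ≤ I.card) (hcard : 2 * K.card + Z.card ≤ I.card + 1)
    (hfree : ∀ e : κ × Bool, e.1 ∈ K → toggle i (x e) ∉ obstacles K x Z) :
    ∃ a ∈ K, ∃ p, IsSplitting I c K x Z i a p := by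
  suffices h : ∃ a ∈ K, ∃ p, ReachableIn (cubeGraph ι)
      (facet I c i (x (a, p) i) \ obstacles (K.erase a) x Z) (x (a, p))
      (Function.update (x (a, !p)) i (x (a, p) i)) by
    obtain ⟨a, ha, p, hreach⟩ := h
    exact ⟨a, ha, p, hreach, fun {e} he hmem =>
      hfree e (Finset.mem_of_mem_erase he) (insert_obstacles_erase_subset ha (!p) hmem)⟩
  by_cases hopp : ∃ a ∈ K, ∃ p, ∃ v ∈ obstacles (K.erase a) x Z, v i ≠ x (a, p) i
  · obtain ⟨a, ha, p, v, hv, hvi⟩ := hopp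
    refine ⟨a, ha, p, reachableIn_update_of_mem_obstacles hi ha hx hcard hv hvi fun hmem => ?_⟩
    rcases update_eq_or_eq_toggle i (x (a, !p)) (x (a, p) i) with h | h <;> rw [h] at hmem
    · exact hx.end_notMem_obstacles_erase ha (!p) hmem
    · exact hfree (a, !p) ha (obstacles_erase_subset hmem)
  · push Not at hopp
    have hJ : (I.erase i).card + 1 = I.card := Finset.card_erase_add_one hi
    obtain ⟨a, ha, hfar⟩ := exists_forall_toggle_notMem_obstacles (J := I.erase i) (Z := Z) hK
      (by omega) (by omega)
    obtain ⟨b, hb⟩ : (K.erase a).Nonempty := Finset.card_pos.1 (by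
      rw [Finset.card_erase_of_mem ha]; omega)
    have hside (p : Bool) : x (a, p) i = x (b, true) i :=
      (hopp a ha p _ (end_mem_obstacles (e := (b, true)) hb)).symm
    have hmem (p : Bool) : x (a, p) ∈ facet I c i (x (b, true) i) \ obstacles (K.erase a) x Z :=
      mem_facet_diff hi ⟨(hx.mem ha).1, hx.end_notMem_obstacles_erase ha p⟩ (hside p)
    have hle := card_obstacles_erase_add_two_le ha x Z
    refine ⟨a, ha, true, ?_⟩
    rw [Function.update_eq_self_iff.2 ((hside true).trans (hside (!true)).symm), hside]
    exact reachableIn_face_diff_of_not_isolated (by omega) (by omega) (hmem _) (hmem _)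
      (hfar _) (hfar _)

lemma exists_isSplitting (hx : IsPairing (face I c \ Z) K x) (hK : 2 ≤ K.card) (hI : 4 ≤ I.card)
    (hcard : 2 * K.card + Z.card ≤ I.card + 1) :
    ∃ i ∈ I, ∃ a ∈ K, ∃ p, IsSplitting I c K x Z i a p := by
  obtain ⟨i, hi, hedges⟩ := exists_card_directionEdges_le_one (I := I)
    (Finset.card_pos.1 (by omega)) ((card_obstacles_le K x Z).trans hcard)
  refine ⟨i, hi, ?_⟩
  by_cases hfree : ∀ e : κ × Bool, e.1 ∈ K → toggle i (x e) ∉ obstacles K x Z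
  · exact exists_isSplitting_of_forall_toggle_notMem hi hx hK hI hcard hfree
  · push Not at hfree
    obtain ⟨⟨a, p⟩, ha, hai⟩ := hfree
    exact ⟨a, ha, p, isSplitting_of_toggle_mem_obstacles hi ha hx hcard hedges hai⟩

end Splitting

section Linkable

variable {ι κ : Type*} [DecidableEq ι]

theorem linkable_face_diff {I : Finset ι} {c : ι → Bool} {K : Finset κ} {x : κ × Bool → ι → Bool}
    {Z : Finset (ι → Bool)} (hx : IsPairing (face I c \ Z) K x)
    (hcard : 2 * K.card + Z.card ≤ I.card + 1) (hKI : K.card ≤ 1 ∨ 4 ≤ I.card) :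
    Linkable (cubeGraph ι) (face I c \ Z) K x := by
  classical
  induction K using Finset.strongInduction generalizing I c x Z with
  | H K ih =>
    rcases Nat.lt_or_ge 1 K.card with hK | hK
    · obtain ⟨i, hi, a, ha, p, hs⟩ := exists_isSplitting hx hK (by omega) hcard
      have hK' := Finset.card_erase_add_one ha
      have hI' := Finset.card_erase_add_one hi
      have hZ' := Finset.card_insert_le (x (a, !p)) Z
      exact hs.linkable hi ha hx <| ih _ (Finset.erase_ssubset ha)
        (hs.isPairing_update hi ha hx _) (by omega) (by omega)
    · refine .of_card_le_one hK fun a ha => ?_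
      have hpos : 0 < K.card := Finset.card_pos.2 ⟨a, ha⟩
      exact reachableIn_face_diff (by omega) (hx.mem ha) (hx.mem ha)

theorem isKLinked_cubeGraph [Fintype ι] (hι : Fintype.card ι ≠ 3) :
    (cubeGraph ι).IsKLinked ((Fintype.card ι + 1) / 2) := by
  refine isKLinked_of_forall_linkable ?_ fun x hx => ?_
  · have hlt := Nat.lt_two_pow_self (n := Fintype.card ι)
    rw [ENat.card_eq_coe_fintype_card, Fintype.card_fun, Fintype.card_bool, Nat.cast_le]
    omega
  · simpa [face] using linkable_face_diff (I := Finset.univ) (c := fun _ => false) (Z := ∅)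
      (K := Finset.univ) (x := x) ⟨fun _ => by simp [face], fun _ _ h => hx h⟩
      (by rw [Finset.card_univ, Fintype.card_fin, Finset.card_univ, Finset.card_empty]; omega)
      (by rw [Finset.card_univ, Fintype.card_fin, Finset.card_univ]; omega)

end Linkable

end CubeGraph

namespace Polytope

section Exposed

variable {E : Type*} [AddCommGroup E] [Module ℝ E] [TopologicalSpace E] {S F : Set E} {v : E}

lemma extremePoints_subset_of_isExposed (hF : IsExposed ℝ (convexHull ℝ S) F) :
    F.extremePoints ℝ ⊆ S :=
  hF.isExtreme.extremePoints_subset_extremePoints.trans extremePoints_convexHull_subset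

variable [IsTopologicalAddGroup E] [ContinuousSMul ℝ E] [T2Space E] [LocallyConvexSpace ℝ E]

lemma convexHull_extremePoints_of_isExposed (hS : S.Finite)
    (hF : IsExposed ℝ (convexHull ℝ S) F) : convexHull ℝ (F.extremePoints ℝ) = F := by
  have hfin := hS.subset (extremePoints_subset_of_isExposed hF)
  rw [← (hfin.isClosed_convexHull ℝ).closure_eq]
  exact closure_convexHull_extremePoints (hF.isCompact (hS.isCompact_convexHull ℝ))
    (hF.convex (convex_convexHull ℝ S))

lemma isExposed_singleton_of_mem_extremePoints (hS : S.Finite)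
    (hv : v ∈ (convexHull ℝ S).extremePoints ℝ) : IsExposed ℝ (convexHull ℝ S) {v} := by
  have hvn : v ∉ convexHull ℝ (S \ {v}) := fun h =>
    (extremePoints_convexHull_subset (inter_extremePoints_subset_extremePoints_of_subset
      (convexHull_mono Set.sdiff_subset) ⟨h, hv⟩)).2 rfl
  obtain ⟨f, r, hr, hrv⟩ := geometric_hahn_banach_closed_point (convex_convexHull ℝ _)
    ((hS.subset Set.sdiff_subset).isClosed_convexHull ℝ) hvn
  have hF : IsExposed ℝ (convexHull ℝ S) (f.toExposed (convexHull ℝ S)) :=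
    ContinuousLinearMap.toExposed.isExposed
  have hext : (f.toExposed (convexHull ℝ S)).extremePoints ℝ ⊆ {v} := fun w hw => by
    by_contra hwv
    have hlt := (hr w (subset_convexHull ℝ _ ⟨extremePoints_subset_of_isExposed hF hw, hwv⟩)).trans
      hrv
    exact hlt.not_ge (hw.1.2 v hv.1)
  have hsub : f.toExposed (convexHull ℝ S) ⊆ {v} := by
    rw [← convexHull_extremePoints_of_isExposed hS hF]
    exact convexHull_min hext (convex_singleton v)
  have hne : (f.toExposed (convexHull ℝ S)).Nonempty :=
    (hS.isCompact_convexHull ℝ).exists_isMaxOn ⟨v, hv.1⟩ f.continuous.continuousOn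
  exact hne.subset_singleton_iff.1 hsub ▸ hF

end Exposed

section FaceLattice

variable {m n : ℕ} {P : Set (Fin n → ℝ)} {Q : Set (Fin m → ℝ)}

lemma face_eq_convexHull {F : Set (Fin n → ℝ)} (hP : IsPolytope P) (hF : IsExposed ℝ P F) :
    F = convexHull ℝ {v | IsExposed ℝ P {v} ∧ v ∈ F} := by
  obtain ⟨S, hS, rfl⟩ := hP
  refine Set.Subset.antisymm ?_
    (convexHull_min (fun v hv => hv.2) (hF.convex (convex_convexHull ℝ S)))
  nth_rw 1 [← convexHull_extremePoints_of_isExposed hS hF]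
  exact convexHull_mono fun v hv => ⟨isExposed_singleton_of_mem_extremePoints hS
    (hF.isExtreme.extremePoints_subset_extremePoints hv), hv.1⟩

lemma mem_extremePoints (v : Vertex P) : v.1 ∈ P.extremePoints ℝ :=
  exposedPoints_subset_extremePoints (mem_exposedPoints_iff_exposed_singleton.2 v.2)

instance (P : Set (Fin n → ℝ)) : OrderBot (FaceLattice P) where
  bot := ⟨∅, isExposed_empty⟩
  bot_le F := Set.empty_subset F.1

/-- A vertex of a polytope as an element of its face lattice. The vertices are the atoms. -/
def vertexFace (v : Vertex P) : FaceLattice P := ⟨{v.1}, v.2⟩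

lemma vertexFace_le {v : Vertex P} {F : FaceLattice P} : vertexFace v ≤ F ↔ v.1 ∈ F.1 :=
  Set.singleton_subset_iff

lemma vertexFace_injective : Function.Injective (vertexFace (P := P)) := fun _ _ h =>
  Subtype.ext (Set.singleton_injective (congrArg Subtype.val h))

lemma isAtom_vertexFace (v : Vertex P) : IsAtom (vertexFace v) := by
  refine ⟨fun h => Set.singleton_ne_empty v.1 (congrArg Subtype.val h), fun F hF => ?_⟩
  rcases Set.subset_singleton_iff_eq.1 hF.le with h | h
  · exact Subtype.ext h
  · exact absurd (Subtype.ext h) hF.ne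

lemma exists_vertexFace_eq (hP : IsPolytope P) {F : FaceLattice P} (hF : IsAtom F) :
    ∃ v : Vertex P, vertexFace v = F := by
  obtain ⟨v, hv, hvF⟩ : {v | IsExposed ℝ P {v} ∧ v ∈ F.1}.Nonempty := by
    rw [← convexHull_nonempty_iff (𝕜 := ℝ), ← face_eq_convexHull hP F.2,
      Set.nonempty_iff_ne_empty]
    exact fun h => hF.1 (Subtype.ext h)
  exact ⟨⟨v, hv⟩, (hF.le_iff_eq (isAtom_vertexFace _).1).1 (vertexFace_le.2 hvF)⟩

lemma mem_segment_iff (u v w : Vertex P) : w.1 ∈ segment ℝ u.1 v.1 ↔ w = u ∨ w = v := by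
  constructor
  · intro hw
    exact ((mem_extremePoints_iff_forall_segment.1 (mem_extremePoints w)).2 u.1 (u.2.subset rfl)
      v.1 (v.2.subset rfl) hw).imp (fun h => Subtype.ext h.symm) fun h => Subtype.ext h.symm
  · rintro (rfl | rfl)
    exacts [left_mem_segment ℝ _ _, right_mem_segment ℝ _ _]

lemma graph_adj_iff (hP : IsPolytope P) {u v : Vertex P} : (graph P).Adj u v ↔
    u ≠ v ∧ ∃ F : FaceLattice P, ∀ w : Vertex P, vertexFace w ≤ F ↔ w = u ∨ w = v := by
  refine and_congr_right fun _ => ⟨fun h => ⟨⟨_, h⟩, fun w => ?_⟩, fun ⟨F, hF⟩ => ?_⟩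
  · rw [vertexFace_le, mem_segment_iff]
  · have hvertices : {w | IsExposed ℝ P {w} ∧ w ∈ F.1} = {u.1, v.1} := by
      ext w
      constructor
      · rintro ⟨hw, hwF⟩
        exact ((hF ⟨w, hw⟩).1 (vertexFace_le.2 hwF)).imp (congrArg Subtype.val)
          (congrArg Subtype.val)
      · rintro (rfl | rfl)
        · exact ⟨u.2, vertexFace_le.1 ((hF u).2 (.inl rfl))⟩
        · exact ⟨v.2, vertexFace_le.1 ((hF v).2 (.inr rfl))⟩
    rw [← convexHull_pair, ← hvertices, ← face_eq_convexHull hP F.2]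
    exact F.2

lemma exists_vertexEquiv (hP : IsPolytope P) (hQ : IsPolytope Q)
    (φ : FaceLattice P ≃o FaceLattice Q) :
    ∃ f : Vertex P ≃ Vertex Q, ∀ v, vertexFace (f v) = φ (vertexFace v) := by
  choose f hf using fun v : Vertex P =>
    exists_vertexFace_eq hQ ((φ.isAtom_iff _).2 (isAtom_vertexFace v))
  refine ⟨.ofBijective f ⟨fun u v h => ?_, fun w => ?_⟩, hf⟩
  · exact vertexFace_injective (φ.injective (by rw [← hf, ← hf, h]))
  · obtain ⟨v, hv⟩ := exists_vertexFace_eq hP ((φ.symm.isAtom_iff _).2 (isAtom_vertexFace w))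
    exact ⟨v, vertexFace_injective (by rw [hf, hv, φ.apply_symm_apply])⟩

lemma CombinatoriallyEquivalent.nonempty_graph_iso (hP : IsPolytope P) (hQ : IsPolytope Q)
    (h : CombinatoriallyEquivalent P Q) : Nonempty (graph P ≃g graph Q) := by
  obtain ⟨φ⟩ := h
  obtain ⟨f, hf⟩ := exists_vertexEquiv hP hQ φ
  refine ⟨f, fun {u v} => ?_⟩
  simp only [graph_adj_iff hP, graph_adj_iff hQ, φ.surjective.exists, f.surjective.forall, hf,
    φ.le_iff_le, f.injective.eq_iff, ne_eq]

end FaceLattice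

section StandardCube

open CubeGraph

variable {d : ℕ}

/-- The point of `{0, 1}ᵈ` whose coordinates equal to `1` are the true entries of `u`. -/
def cubePoint (u : Fin d → Bool) : Fin d → ℝ := fun j => if u j then 1 else 0

lemma cubePoint_eq_zero_or_eq_one (u : Fin d → Bool) (j : Fin d) :
    cubePoint u j = 0 ∨ cubePoint u j = 1 := by
  cases h : u j <;> simp [cubePoint, h]

lemma cubePoint_mem (u : Fin d → Bool) : cubePoint u ∈ Set.Icc (0 : Fin d → ℝ) 1 := by
  constructor <;> intro j <;> cases h : u j <;> simp [cubePoint, h]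

lemma cubePoint_injective : Function.Injective (cubePoint (d := d)) := fun u v h => by
  funext j
  have hj := congrFun h j
  cases hu : u j <;> cases hv : v j <;> simp_all [cubePoint]

lemma cubePoint_update (u : Fin d → Bool) (i : Fin d) (b : Bool) :
    cubePoint (Function.update u i b) = Function.update (cubePoint u) i (if b then 1 else 0) :=
  Function.comp_update (fun b : Bool => (if b then 1 else 0 : ℝ)) u i b

lemma isPolytope_cube (d : ℕ) : IsPolytope (Set.Icc (0 : Fin d → ℝ) 1) := by
  refine ⟨Set.univ.pi fun _ => {0, 1}, Set.Finite.pi fun _ => Set.toFinite _, ?_⟩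
  simp [convexHull_pi, convexHull_pair, segment_eq_Icc, ← Set.pi_univ_Icc]

lemma isExposed_cube_facet (u : Fin d → Bool) (j : Fin d) :
    IsExposed ℝ (Set.Icc (0 : Fin d → ℝ) 1) {x ∈ Set.Icc 0 1 | x j = cubePoint u j} := fun _ => by
  have hmax {x : Fin d → ℝ} (hx : x ∈ Set.Icc 0 1) : x j = cubePoint u j ↔
      ∀ y ∈ Set.Icc (0 : Fin d → ℝ) 1, (2 * cubePoint u j - 1) * y j ≤
        (2 * cubePoint u j - 1) * x j := by
    refine ⟨fun h y hy => ?_, fun h => ?_⟩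
    · have h0 : 0 ≤ y j := hy.1 j
      have h1 : y j ≤ 1 := hy.2 j
      rcases cubePoint_eq_zero_or_eq_one u j with hu | hu <;> rw [h, hu] <;> linarith
    · have h0 : 0 ≤ x j := hx.1 j
      have h1 : x j ≤ 1 := hx.2 j
      have hle := h _ (cubePoint_mem u)
      rcases cubePoint_eq_zero_or_eq_one u j with hu | hu <;> rw [hu] at hle ⊢ <;> linarith
  exact ⟨(2 * cubePoint u j - 1) • ContinuousLinearMap.proj (R := ℝ) j,
    Set.ext fun x => and_congr_right hmax⟩

lemma isExposed_cube_face (u : Fin d → Bool) (D : Finset (Fin d)) :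
    IsExposed ℝ (Set.Icc (0 : Fin d → ℝ) 1) {x ∈ Set.Icc 0 1 | ∀ j ∈ D, x j = cubePoint u j} := by
  induction D using Finset.induction_on with
  | empty => simpa using! IsExposed.refl (𝕜 := ℝ) (Set.Icc (0 : Fin d → ℝ) 1)
  | insert i D _ ih =>
    simpa only [Finset.forall_mem_insert, Set.sep_and] using (isExposed_cube_facet u i).inter ih

lemma isExposed_cubePoint (u : Fin d → Bool) :
    IsExposed ℝ (Set.Icc (0 : Fin d → ℝ) 1) {cubePoint u} := by
  convert isExposed_cube_face u Finset.univ using 1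
  ext x
  simpa [← funext_iff] using fun h : x = cubePoint u => h ▸ cubePoint_mem u

lemma segment_cubePoint_toggle (u : Fin d → Bool) (i : Fin d) :
    segment ℝ (cubePoint u) (cubePoint (toggle i u)) =
      Function.update (cubePoint u) i '' Set.Icc 0 1 := by
  have hu : cubePoint u = Function.update (cubePoint u) i (if u i then 1 else 0) := by
    simp [cubePoint]
  rw [toggle, cubePoint_update]
  nth_rw 1 [hu]
  rw [← Pi.image_update_segment]
  cases u i
  · simp [segment_eq_Icc]
  · simp [segment_symm ℝ (1 : ℝ) 0, segment_eq_Icc]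

lemma isExposed_segment_toggle (u : Fin d → Bool) (i : Fin d) :
    IsExposed ℝ (Set.Icc (0 : Fin d → ℝ) 1)
      (segment ℝ (cubePoint u) (cubePoint (toggle i u))) := by
  convert isExposed_cube_face u (Finset.univ.erase i) using 1
  refine Set.Subset.antisymm (fun x hx => ⟨?_, fun j hj => ?_⟩) fun x ⟨hx, h⟩ => ?_
  · exact (convex_Icc _ _).segment_subset (cubePoint_mem u) (cubePoint_mem _) hx
  · rw [segment_cubePoint_toggle] at hx
    obtain ⟨r, -, rfl⟩ := hx
    exact Function.update_of_ne (Finset.ne_of_mem_erase hj) _ _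
  · rw [segment_cubePoint_toggle]
    refine ⟨x i, ⟨hx.1 i, hx.2 i⟩, (Function.eq_update_iff.2 ⟨rfl, fun j hj => ?_⟩).symm⟩
    exact h j (by simp [hj])

/-- The vertex `cubePoint u` of the standard cube, identifying its vertex set with
`Fin d → Bool`. -/
def cubeVertex (u : Fin d → Bool) : Vertex (Set.Icc (0 : Fin d → ℝ) 1) :=
  ⟨cubePoint u, isExposed_cubePoint u⟩

lemma cubeVertex_bijective : Function.Bijective (cubeVertex (d := d)) := by
  refine ⟨fun u v h => cubePoint_injective (congrArg Subtype.val h), fun v => ?_⟩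
  have hv : v.1 ∈ (Set.univ.pi fun _ => Set.Icc (0 : ℝ) 1).extremePoints ℝ := by
    rw [Set.pi_univ_Icc]
    exact mem_extremePoints v
  rw [extremePoints_pi] at hv
  refine ⟨fun j => decide (v.1 j = 1), Subtype.ext (funext fun j => ?_)⟩
  have hj : v.1 j = 0 ∨ v.1 j = 1 := by
    simpa [Set.extremePoints_Icc zero_le_one] using hv j (Set.mem_univ j)
  rcases hj with h | h <;> simp [cubeVertex, cubePoint, h]

lemma graph_cube_adj {u v : Fin d → Bool} :
    (cubeGraph (Fin d)).Adj u v →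
      (graph (Set.Icc (0 : Fin d → ℝ) 1)).Adj (cubeVertex u) (cubeVertex v) := by
  rintro ⟨i, rfl⟩
  exact ⟨fun h => toggle_ne_self i u (cubeVertex_bijective.1 h).symm, isExposed_segment_toggle u i⟩

theorem isKLinked_graph_cube (hd : d ≠ 3) :
    (graph (Set.Icc (0 : Fin d → ℝ) 1)).IsKLinked ((d + 1) / 2) := by
  simpa using isKLinked_of_bijective_hom ⟨cubeVertex, graph_cube_adj⟩ cubeVertex_bijective
    (isKLinked_cubeGraph (ι := Fin d) (by simpa using hd))

end StandardCube

end Polytope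

theorem mainTheorem2 (d : ℕ) (hd : d ≠ 3) (n : ℕ) (P : Set (Fin n → ℝ))
    (hP : Polytope.IsCube d P) :
    (Polytope.graph P).IsKLinked ((d + 1) / 2) := by
  obtain ⟨φ⟩ := hP.2.nonempty_graph_iso hP.1 (Polytope.isPolytope_cube d)
  exact CubeGraph.isKLinked_of_bijective_hom φ.symm.toHom φ.symm.bijective
    (Polytope.isKLinked_graph_cube hd)
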